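/- **Theorem (bi-Hamiltonian cohomology of a Lie–Poisson pair is reduced cohomology).** Let $\mathbb K$ be $\mathbb R$ or $\mathbb C$; "smooth" means $C^\infty$ if $\mathbb K=\mathbb R$ and holomorphic if $\mathbb K=\mathbb C$. Let $(\mathfrak g,[-,-]_1,[-,-]_2)$ be a finite-dimensional compatible Lie algebra over $\mathbb K$: $\pi_1=[-,-]_1$ and $\pi_2=[-,-]_2$ are Lie brackets on $\mathfrak g$ with $$[[x,y]_2,z]_1+[[y,z]_2,x]_1+[[z,x]_2,y]_1+[[x,y]_1,z]_2+[[y,z]_1,x]_2+[[z,x]_1,y]_2=0\quad(x,y,z\in\mathfrak g).$$ For $x\in\mathfrak g$ let $l_x(\xi)=\langle x,\xi\rangle$ be the corresponding linear function on $\mathfrak g^*$, and for $i=1,2$ let $\Pi_i$ be the Lie–Poisson bivector field on $\mathfrak g^*$ determined by $\Pi_i(dl_x,dl_y)=l_{[x,y]_i}$, with Poisson bracket $\{f,h\}_i=\Pi_i(df,dh)$. Let $\mathfrak X^p(\mathfrak g^*)$ be the space of smooth $p$-vector fields on $\mathfrak g^*$, and $\delta^p_{\Pi_i}P=(-1)^{p-1}[\Pi_i,P]_S$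 for $P\in\mathfrak X^p(\mathfrak g^*)$. Here $[P,Q]_S=P\circ Q-(-1)^{(p-1)(q-1)}Q\circ P$ is the Schouten bracket of $P\in\mathfrak X^p$, $Q\in\mathfrak X^q$, with $(P\circ Q)(F_1,\dots,F_{p+q-1})=\sum_\sigma \operatorname{sgn}(\sigma)\,P(Q(F_{\sigma(1)},\dots,F_{\sigma(q)}),F_{\sigma(q+1)},\dots,F_{\sigma(p+q-1)})$ over the $(q,p-1)$-unshuffles $\sigma$ (and $P\circ Q=0$ if $p=0$), multivector fields acting on functions $F_j$ through their differentials. Put $\rho(x)f=\{l_x,f\}_1$ and $\mu(x)f=\{l_x,f\}_2$ for $x\in\mathfrak g$, $f\in C^\infty(\mathfrak g^*)$ (the smooth functions), let $C^n(\mathfrak g,C^\infty(\mathfrak g^*))=\operatorname{Hom}(\wedge^n\mathfrak g,C^\infty(\mathfrak g^*))$, and let $d_{\pi_1+\rho}$, $d_{\pi_2+\mu}$ be the Chevalley–Eilenberg coboundary operators on it for $([-,-]_1,\rho)$ and $([-,-]_2,\mu)$. Then every linear combination of $\Pi_1$ and $\Pi_2$ is a Poisson structure; $\rho$ and $\mu$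 are representations of $(\mathfrak g,[-,-]_1)$ and $(\mathfrak g,[-,-]_2)$, and $\rho([x,y]_2)+\mu([x,y]_1)=[\rho(x),\mu(y)]-[\rho(y),\mu(x)]$; each of the pairs $(\delta_{\Pi_1},\delta_{\Pi_2})$ and $(d_{\pi_1+\rho},d_{\pi_2+\mu})$ consists of two anticommuting differentials of square zero. Hence $(\ker\delta_{\Pi_1},\delta_{\Pi_2})$ (the bi-Hamiltonian cohomology complex, with cohomology $\tilde H^n(\mathfrak g^*,\Pi_1,\Pi_2)$) and $(\ker d_{\pi_1+\rho},d_{\pi_2+\mu})$ (the reduced cohomology complex, with cohomology $\tilde H^n(\mathfrak g,C^\infty(\mathfrak g^*))$) are cochain complexes. There is an isomorphism of cochain complexes $$\Psi:(\ker\delta_{\Pi_1},\delta_{\Pi_2})\xrightarrow{\ \cong\ }(\ker d_{\pi_1+\rho},d_{\pi_2+\mu}),\qquad \Psi_p(P)(x_1,\dots,x_p)=P(dl_{x_1},\dots,dl_{x_p}),$$ and for every $n\ge 0$ it induces an isomorphism $\tilde H^n(\mathfrak g^*,\Pi_1,\Pi_2)\cong\tilde H^n(\mathfrak g,C^\infty(\mathfrak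 g^*))$. -/

import Mathlib

open scoped ContDiff
open CategoryTheory

universe u v w

/-! ### Compatible Lie algebras and their representations -/

/-- A Lie algebra structure on the vector space `g`: an alternating bilinear bracket satisfying the
Jacobi identity. (Two such structures have to live on one and the same vector space, so the class
`LieAlgebra` is not convenient here.) -/
structure LieStructure (𝕜 : Type u) (g : Type v) [Field 𝕜] [AddCommGroup g] [Module 𝕜 g] where
  /-- the bracket -/
  br : g →ₗ[𝕜] g →ₗ[𝕜] g
  self_eq_zero : ∀ x, br x x = 0
  jacobi : ∀ x y z, br (br x y) z + br (br y z) x + br (br z x) y = 0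

/-- A compatible Lie algebra: two Lie brackets on `g` with the mixed Jacobi identity. -/
structure CompatibleLieStructure (𝕜 : Type u) (g : Type v) [Field 𝕜] [AddCommGroup g]
    [Module 𝕜 g] where
  /-- the first Lie bracket -/
  fst : LieStructure 𝕜 g
  /-- the second Lie bracket -/
  snd : LieStructure 𝕜 g
  compatible : ∀ x y z,
    fst.br (snd.br x y) z + fst.br (snd.br y z) x + fst.br (snd.br z x) y +
      snd.br (fst.br x y) z + snd.br (fst.br y z) x + snd.br (fst.br z x) y = 0

section Algebra

variable {𝕜 : Type u} {g : Type v} [Field 𝕜] [AddCommGroup g] [Module 𝕜 g]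
  {V : Type w} [AddCommGroup V] [Module 𝕜 V]

/-- `ρ` is a representation on `V` of the Lie algebra `(g, π)`. -/
def LieStructure.IsRepresentation (π : LieStructure 𝕜 g) (ρ : g →ₗ[𝕜] Module.End 𝕜 V) : Prop :=
  ∀ x y, ρ (π.br x y) = ⁅ρ x, ρ y⁆

/-- `(ρ, μ)` is a representation on `V` of the compatible Lie algebra `(g, L)`. -/
structure CompatibleLieStructure.IsRepresentation (L : CompatibleLieStructure 𝕜 g)
    (ρ μ : g →ₗ[𝕜] Module.End 𝕜 V) : Prop where
  fst : L.fst.IsRepresentation ρ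
  snd : L.snd.IsRepresentation μ
  mixed : ∀ x y, ρ (L.snd.br x y) + μ (L.fst.br x y) = ⁅ρ x, μ y⁆ - ⁅ρ y, μ x⁆

/-! ### The Chevalley-Eilenberg coboundary operator -/

/-- The part of the coboundary that involves the action,
`x ↦ ∑ i, (-1) ^ i • ρ (x i) (f (x without x i))`. -/
def ceActionPart (ρ : g →ₗ[𝕜] Module.End 𝕜 V) (n : ℕ) :
    (g [⋀^Fin n]→ₗ[𝕜] V) →ₗ[𝕜] (g [⋀^Fin (n + 1)]→ₗ[𝕜] V) where
  toFun f := AlternatingMap.alternatizeUncurryFin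
    { toFun := fun x => (ρ x).compAlternatingMap f
      map_add' := fun x y => by ext; simp
      map_smul' := fun c x => by ext; simp }
  map_add' f f' := by
    ext x
    simp [AlternatingMap.alternatizeUncurryFin_apply, Finset.sum_add_distrib]
  map_smul' c f := by
    ext x
    simp [AlternatingMap.alternatizeUncurryFin_apply, Finset.smul_sum, smul_comm c]

/-- The bilinear map `(x, y) ↦ f ([x, y], ⬝, …, ⬝)`. -/
def ceBracketAux (π : LieStructure 𝕜 g) {n : ℕ} (f : g [⋀^Fin (n + 1)]→ₗ[𝕜] V) :
    g →ₗ[𝕜] g →ₗ[𝕜] g [⋀^Fin n]→ₗ[𝕜] V :=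
  π.br.compr₂ f.curryLeft

/-- The part of the coboundary that involves the bracket: with positions counted from `0`, it is
`x ↦ ∑_{i < k} (-1) ^ (i + k) • f ([x i, x k], x without x i and x k)`; it is zero for `n = 0`.
It is written as `- 1 / 2` times the total alternatization, see `ceBracketPart_succ_apply` for the
sum over `i < k`. -/
def ceBracketPart (π : LieStructure 𝕜 g) : (n : ℕ) →
    (g [⋀^Fin n]→ₗ[𝕜] V) →ₗ[𝕜] (g [⋀^Fin (n + 1)]→ₗ[𝕜] V)
  | 0 => 0
  | n + 1 =>
    { toFun := fun f => (-(2 : 𝕜)⁻¹) • AlternatingMap.alternatizeUncurryFin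
        (AlternatingMap.alternatizeUncurryFinLM ∘ₗ ceBracketAux π f)
      map_add' := fun f f' => by
        rw [← smul_add, ← AlternatingMap.alternatizeUncurryFin_add, ← LinearMap.comp_add]
        rfl
      map_smul' := fun c f => by
        have h1 : AlternatingMap.alternatizeUncurryFinLM ∘ₗ ceBracketAux π (c • f) =
            c • (AlternatingMap.alternatizeUncurryFinLM ∘ₗ ceBracketAux π f) := by
          rw [← LinearMap.comp_smul]
          rfl
        rw [h1, AlternatingMap.alternatizeUncurryFin_smul, smul_comm, RingHom.id_apply] }

/-- The Chevalley-Eilenberg coboundary operator `d_{π + ρ}` on `C^n(g, V) = Hom(∧^n g, V)`. -/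
def ceDifferential (π : LieStructure 𝕜 g) (ρ : g →ₗ[𝕜] Module.End 𝕜 V) (n : ℕ) :
    (g [⋀^Fin n]→ₗ[𝕜] V) →ₗ[𝕜] (g [⋀^Fin (n + 1)]→ₗ[𝕜] V) :=
  ceActionPart ρ n + ceBracketPart π n

theorem LieStructure.br_swap (π : LieStructure 𝕜 g) (x y : g) : π.br y x = -π.br x y := by
  have h := π.self_eq_zero (x + y)
  simp only [map_add, LinearMap.add_apply, π.self_eq_zero, zero_add, add_zero] at h
  exact eq_neg_of_add_eq_zero_left h

theorem ceActionPart_apply (ρ : g →ₗ[𝕜] Module.End 𝕜 V) {n : ℕ} (f : g [⋀^Fin n]→ₗ[𝕜] V)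
    (x : Fin (n + 1) → g) :
    ceActionPart ρ n f x = ∑ i : Fin (n + 1), (-1) ^ (i : ℕ) • ρ (x i) (f (i.removeNth x)) := by
  simp [ceActionPart, AlternatingMap.alternatizeUncurryFin_apply]

/-- The pairs `i < k` of positions are written as `(i.castSucc, j.succ)` with `i ≤ j`; so
`(-1) ^ (i + k) = - (-1) ^ (i + j)`. -/
theorem ceBracketPart_succ_apply [CharZero 𝕜] (π : LieStructure 𝕜 g) {n : ℕ}
    (f : g [⋀^Fin (n + 1)]→ₗ[𝕜] V) (x : Fin (n + 2) → g) :
    ceBracketPart π (n + 1) f x =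
      ∑ i : Fin (n + 1), ∑ j ≥ i, (-1 : ℤ) ^ ((i : ℕ) + (j : ℕ) + 1) •
        f (Matrix.vecCons (π.br (x i.castSucc) (x j.succ))
          (j.removeNth (i.castSucc.removeNth x))) := by
  change (-(2 : 𝕜)⁻¹) • (AlternatingMap.alternatizeUncurryFin
    (AlternatingMap.alternatizeUncurryFinLM ∘ₗ ceBracketAux π f)) x = _
  rw [AlternatingMap.alternatizeUncurryFin_alternatizeUncurryFinLM_comp_apply, Finset.smul_sum]
  refine Finset.sum_congr rfl fun i _ => ?_
  rw [Finset.smul_sum]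
  refine Finset.sum_congr rfl fun j _ => ?_
  have h2 : (2 : 𝕜) ≠ 0 := two_ne_zero
  simp only [ceBracketAux, LinearMap.compr₂_apply, π.br_swap (x i.castSucc) (x j.succ), map_neg,
    AlternatingMap.neg_apply, sub_neg_eq_add, ← two_smul 𝕜 (f.curryLeft _ _), pow_succ,
    mul_neg, mul_one, neg_smul]
  rw [smul_comm, smul_smul, inv_mul_cancel₀ h2, one_smul]
  rfl

/-! ### The subcomplex of cocycles of the first of two anticommuting differentials -/

/-- `a` and `b` are differentials of degree one on the graded vector space `C`, which anticommute
with each other. -/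
structure AnticommutingDifferentials {C : ℕ → Type w} [∀ n, AddCommGroup (C n)]
    [∀ n, Module 𝕜 (C n)] (a b : ∀ n, C n →ₗ[𝕜] C (n + 1)) : Prop where
  sq_fst : ∀ n x, a (n + 1) (a n x) = 0
  sq_snd : ∀ n x, b (n + 1) (b n x) = 0
  anticomm : ∀ n x, a (n + 1) (b n x) + b (n + 1) (a n x) = 0

/-- The cochain complex `(ker a, b)`. -/
noncomputable def kernelComplex {C : ℕ → Type w} [∀ n, AddCommGroup (C n)]
    [∀ n, Module 𝕜 (C n)] {a b : ∀ n, C n →ₗ[𝕜] C (n + 1)}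
    (h : AnticommutingDifferentials a b) : CochainComplex (ModuleCat.{w} 𝕜) ℕ :=
  CochainComplex.of (fun n => ModuleCat.of 𝕜 (LinearMap.ker (a n)))
    (fun n => ModuleCat.ofHom ((b n).restrict (fun x hx => by
      have h1 := h.anticomm n x
      rw [LinearMap.mem_ker] at hx ⊢
      rwa [hx, map_zero, add_zero] at h1)))
    (fun n => by
      refine ModuleCat.hom_ext (LinearMap.ext fun x => Subtype.ext ?_)
      exact h.sq_snd n x.1)

/-- The reduced cohomology complex of the compatible Lie algebra `(g, L)` with coefficients in
`(V; ρ, μ)`: the kernel of `d_{π₁ + ρ}` with the differential `d_{π₂ + μ}`. -/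
noncomputable abbrev reducedComplex {L : CompatibleLieStructure 𝕜 g}
    {ρ μ : g →ₗ[𝕜] Module.End 𝕜 V}
    (h : AnticommutingDifferentials (C := fun n => g [⋀^Fin n]→ₗ[𝕜] V)
      (ceDifferential L.fst ρ) (ceDifferential L.snd μ)) :=
  kernelComplex h

end Algebra

/-! ### Smooth functions and multivector fields on a finite dimensional vector space

Here `𝕜` is `ℝ` or `ℂ`, and `ContDiff 𝕜 ∞` means smooth if `𝕜 = ℝ`, holomorphic if `𝕜 = ℂ`. -/

section Geometry

variable (𝕜 : Type u) [RCLike 𝕜] (E : Type v) [NormedAddCommGroup E] [NormedSpace 𝕜 E]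

/-- The space of smooth functions on `E`. -/
def SmoothFunction : Submodule 𝕜 (E → 𝕜) where
  carrier := {f | ContDiff 𝕜 ∞ f}
  add_mem' := fun {f h} (hf : ContDiff 𝕜 ∞ f) (hh : ContDiff 𝕜 ∞ h) => hf.add hh
  zero_mem' := (contDiff_const : ContDiff 𝕜 ∞ fun _ : E => (0 : 𝕜))
  smul_mem' := fun c f (hf : ContDiff 𝕜 ∞ f) => hf.const_smul c

/-- The space `𝔛^p(E) = Γ(∧^p TE)` of smooth `p`-vector fields on the finite dimensional space `E`.
An element of `∧^p T_ξ E` is regarded as an alternating `p`-linear form on the cotangent space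
`T_ξ^* E = E^*`; the field is smooth if its components are. -/
def MultivectorField (p : ℕ) : Submodule 𝕜 (E → (StrongDual 𝕜 E) [⋀^Fin p]→ₗ[𝕜] 𝕜) where
  carrier := {P | ∀ α, ContDiff 𝕜 ∞ fun ξ => P ξ α}
  add_mem' := fun hP hQ α => (hP α).add (hQ α)
  zero_mem' := fun _ => contDiff_const
  smul_mem' := fun c _ hP α => (hP α).const_smul c

variable {𝕜 E}

theorem smoothFunction_contDiff (f : SmoothFunction 𝕜 E) : ContDiff 𝕜 ∞ f.1 := f.2

theorem smoothFunction_differentiableAt (f : SmoothFunction 𝕜 E) (ξ : E) :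
    DifferentiableAt 𝕜 f.1 ξ :=
  ((smoothFunction_contDiff f).differentiable (by simp)) ξ

theorem multivector_contDiff {p : ℕ} (P : MultivectorField 𝕜 E p)
    (α : Fin p → StrongDual 𝕜 E) : ContDiff 𝕜 ∞ fun ξ => P.1 ξ α := P.2 α

theorem multivector_differentiableAt {p : ℕ} (P : MultivectorField 𝕜 E p)
    (α : Fin p → StrongDual 𝕜 E) (ξ : E) : DifferentiableAt 𝕜 (fun ξ => P.1 ξ α) ξ :=
  ((multivector_contDiff P α).differentiable (by simp)) ξ

/-- Evaluating a smooth multivector field on smooth `1`-forms gives a smooth function. -/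
theorem multivector_contDiff_apply [FiniteDimensional 𝕜 E] {p : ℕ}
    (P : MultivectorField 𝕜 E p) (θ : Fin p → E → StrongDual 𝕜 E)
    (hθ : ∀ i, ContDiff 𝕜 ∞ (θ i)) : ContDiff 𝕜 ∞ fun ξ => P.1 ξ fun i => θ i ξ := by
  let b := Module.finBasis 𝕜 (StrongDual 𝕜 E)
  have key : (fun ξ => P.1 ξ fun i => θ i ξ) = fun ξ =>
      ∑ r : Fin p → Fin (Module.finrank 𝕜 (StrongDual 𝕜 E)),
        (∏ i, b.repr (θ i ξ) (r i)) • P.1 ξ fun i => b (r i) := by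
    funext ξ
    have h1 : (fun i => θ i ξ) = fun i => ∑ j, b.repr (θ i ξ) j • b j := by
      funext i
      exact (b.sum_repr (θ i ξ)).symm
    rw [h1]
    have h2 := (P.1 ξ).toMultilinearMap.map_sum (fun i j => b.repr (θ i ξ) j • b j)
    refine h2.trans (Finset.sum_congr rfl fun r _ => ?_)
    exact (P.1 ξ).toMultilinearMap.map_smul_univ (fun i => b.repr (θ i ξ) (r i)) fun i => b (r i)
  rw [key]
  simp only [smul_eq_mul]
  refine ContDiff.sum fun r _ => ContDiff.mul (contDiff_prod fun i _ => ?_)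
    (multivector_contDiff P _)
  exact (LinearMap.toContinuousLinearMap (b.coord (r i))).contDiff.comp (hθ i)

/-! ### The Schouten bracket -/

/-- The differential at `ξ` of the components of `Q`, that is, the alternating map
`(α₁, …, α_q) ↦ d_ξ (Q (α₁, …, α_q))` with values in the cotangent space. -/
noncomputable def multivectorDerivAt {q : ℕ} (Q : MultivectorField 𝕜 E q) (ξ : E) :
    (StrongDual 𝕜 E) [⋀^Fin q]→ₗ[𝕜] StrongDual 𝕜 E where
  toFun α := fderiv 𝕜 (fun η => Q.1 η α) ξ
  map_update_add' := fun {inst} α i x y => by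
    rw [← fderiv_fun_add (multivector_differentiableAt Q _ ξ) (multivector_differentiableAt Q _ ξ)]
    congr 1
    funext η
    cases Subsingleton.elim inst (instDecidableEqFin q)
    exact (Q.1 η).map_update_add α i x y
  map_update_smul' := fun {inst} α i c x => by
    rw [← fderiv_fun_const_smul (multivector_differentiableAt Q _ ξ)]
    congr 1
    funext η
    cases Subsingleton.elim inst (instDecidableEqFin q)
    exact (Q.1 η).map_update_smul α i c x
  map_eq_zero_of_eq' := fun α i j h hij => by
    have h0 : (fun η => Q.1 η α) = fun _ => (0 : 𝕜) := by
      funext η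
      exact (Q.1 η).map_eq_zero_of_eq α h hij
    rw [h0]
    simp

/-- The multilinear map
`(α₁, …, α_n) ↦ P_ξ (d_ξ (Q (α₁, …, α_q)), α_{q+1}, …, α_n)`. -/
noncomputable def insertionMultilinear {p q n : ℕ} (h : q + p = n)
    (P : MultivectorField 𝕜 E (p + 1)) (Q : MultivectorField 𝕜 E q) (ξ : E) :
    MultilinearMap 𝕜 (fun _ : Fin n => StrongDual 𝕜 E) 𝕜 :=
  MultilinearMap.domDomCongr (finSumFinEquiv.trans (finCongr h))
    (MultilinearMap.uncurrySum
      ((AlternatingMap.toMultilinearMapLM ∘ₗ (P.1 ξ).curryLeft).compMultilinearMap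
        (multivectorDerivAt Q ξ).toMultilinearMap))

theorem insertionMultilinear_apply {p q n : ℕ} (h : q + p = n)
    (P : MultivectorField 𝕜 E (p + 1)) (Q : MultivectorField 𝕜 E q) (ξ : E)
    (α : Fin n → StrongDual 𝕜 E) :
    insertionMultilinear h P Q ξ α =
      P.1 ξ (Fin.cons (fderiv 𝕜 (fun η => Q.1 η fun i => α (Fin.cast h (Fin.castAdd p i))) ξ)
        (fun j => α (Fin.cast h (Fin.natAdd q j)))) := by
  rfl

variable [FiniteDimensional 𝕜 E]

theorem insertionMultilinear_contDiff {p q n : ℕ} (h : q + p = n)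
    (P : MultivectorField 𝕜 E (p + 1)) (Q : MultivectorField 𝕜 E q)
    (α : Fin n → StrongDual 𝕜 E) : ContDiff 𝕜 ∞ fun ξ => insertionMultilinear h P Q ξ α := by
  simp only [insertionMultilinear_apply]
  have key := multivector_contDiff_apply P
    (fun i : Fin (p + 1) => fun ξ => (Fin.cons
      (fderiv 𝕜 (fun η => Q.1 η fun i => α (Fin.cast h (Fin.castAdd p i))) ξ)
      (fun j => α (Fin.cast h (Fin.natAdd q j))) : Fin (p + 1) → StrongDual 𝕜 E) i)
    (fun i => by
      refine Fin.cases ?_ (fun j => ?_) i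
      · simp only [Fin.cons_zero]
        exact (multivector_contDiff Q _).fderiv_right (by simp)
      · simp only [Fin.cons_succ]
        exact contDiff_const)
  exact key

/-- The insertion `P ∘ Q` of a `q`-vector field into a `p`-vector field,
`(P ∘ Q) (F₁, …, F_n) = ∑_σ sgn σ • P (Q (F_σ(1), …, F_σ(q)), F_σ(q+1), …, F_σ(n))`,
where `n = p + q - 1`, where `P` and `Q` are regarded as multiderivations of the algebra of
functions, and where `σ` runs through the `(q, p - 1)`-unshuffles; equivalently, `1 / (q! (p - 1)!)`
times the sum over all permutations. It is zero for `p = 0`. To get the value at covectors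
`α₁, …, α_n`, the functions `F_i` are taken to be these linear functions on `E`. -/
noncomputable def schoutenInsertion : {p q n : ℕ} → (h : p + q = n + 1) →
    MultivectorField 𝕜 E p → MultivectorField 𝕜 E q → MultivectorField 𝕜 E n
  | 0, _, _, _, _, _ => 0
  | p + 1, q, n, h, P, Q =>
    ⟨fun ξ => ((q.factorial * p.factorial : ℕ) : 𝕜)⁻¹ •
      MultilinearMap.alternatization
        (insertionMultilinear (show q + p = n by omega) P Q ξ), fun α => by
      simp only [AlternatingMap.smul_apply, MultilinearMap.alternatization_apply]
      refine ContDiff.const_smul _ (ContDiff.sum fun σ _ => ?_)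
      exact ContDiff.const_smul (Equiv.Perm.sign σ : ℤˣ)
        (insertionMultilinear_contDiff _ P Q (α ∘ σ))⟩

/-- The Schouten bracket
`[P, Q]_S = P ∘ Q - (-1) ^ ((p - 1) * (q - 1)) Q ∘ P ∈ 𝔛^n(E)`, `n = p + q - 1`, of `P ∈ 𝔛^p(E)` and
`Q ∈ 𝔛^q(E)`. (The exponent is written as `(p + 1) * (q + 1)`, which has the same parity.) -/
noncomputable def schouten {p q n : ℕ} (h : p + q = n + 1) (P : MultivectorField 𝕜 E p)
    (Q : MultivectorField 𝕜 E q) : MultivectorField 𝕜 E n :=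
  schoutenInsertion h P Q -
    (-1 : 𝕜) ^ ((p + 1) * (q + 1)) • schoutenInsertion (show q + p = n + 1 by omega) Q P

theorem schoutenInsertion_succ_apply {p q n : ℕ} (h : p + 1 + q = n + 1)
    (P : MultivectorField 𝕜 E (p + 1)) (Q : MultivectorField 𝕜 E q) (ξ : E)
    (α : Fin n → StrongDual 𝕜 E) :
    (schoutenInsertion h P Q).1 ξ α = ((q.factorial * p.factorial : ℕ) : 𝕜)⁻¹ *
      ∑ σ : Equiv.Perm (Fin n), Equiv.Perm.sign σ •
        insertionMultilinear (show q + p = n by omega) P Q ξ (α ∘ σ) := by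
  simp only [schoutenInsertion, AlternatingMap.smul_apply, MultilinearMap.alternatization_apply,
    smul_eq_mul]
  rfl

theorem schoutenInsertion_add_right {p q n : ℕ} (h : p + q = n + 1)
    (P : MultivectorField 𝕜 E p) (Q Q' : MultivectorField 𝕜 E q) :
    schoutenInsertion h P (Q + Q') = schoutenInsertion h P Q + schoutenInsertion h P Q' := by
  cases p with
  | zero => simp [schoutenInsertion]
  | succ p =>
    refine Subtype.ext (funext fun ξ => AlternatingMap.ext fun α => ?_)
    change _ = (schoutenInsertion h P Q).1 ξ α + (schoutenInsertion h P Q').1 ξ α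
    simp only [schoutenInsertion_succ_apply, ← mul_add, ← Finset.sum_add_distrib, ← smul_add]
    refine congrArg _ (Finset.sum_congr rfl fun σ _ => congrArg _ ?_)
    have hd (β : Fin q → StrongDual 𝕜 E) : fderiv 𝕜 (fun η => (Q + Q').1 η β) ξ =
        fderiv 𝕜 (fun η => Q.1 η β) ξ + fderiv 𝕜 (fun η => Q'.1 η β) ξ :=
      fderiv_fun_add (multivector_differentiableAt Q β ξ) (multivector_differentiableAt Q' β ξ)
    simp only [insertionMultilinear_apply, hd]
    exact DFunLike.congr_fun ((P.1 ξ).curryLeft.map_add _ _) _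

theorem schoutenInsertion_smul_right {p q n : ℕ} (h : p + q = n + 1) (c : 𝕜)
    (P : MultivectorField 𝕜 E p) (Q : MultivectorField 𝕜 E q) :
    schoutenInsertion h P (c • Q) = c • schoutenInsertion h P Q := by
  cases p with
  | zero => simp [schoutenInsertion]
  | succ p =>
    refine Subtype.ext (funext fun ξ => AlternatingMap.ext fun α => ?_)
    change _ = c * (schoutenInsertion h P Q).1 ξ α
    simp only [schoutenInsertion_succ_apply]
    rw [mul_left_comm]
    congr 1
    rw [Finset.mul_sum]
    refine Finset.sum_congr rfl fun σ _ => ?_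
    rw [mul_smul_comm]
    congr 1
    have hd (β : Fin q → StrongDual 𝕜 E) : fderiv 𝕜 (fun η => (c • Q).1 η β) ξ =
        c • fderiv 𝕜 (fun η => Q.1 η β) ξ :=
      fderiv_fun_const_smul (multivector_differentiableAt Q β ξ) c
    simp only [insertionMultilinear_apply, hd]
    exact DFunLike.congr_fun ((P.1 ξ).curryLeft.map_smul c _) _

theorem schoutenInsertion_add_left {p q n : ℕ} (h : p + q = n + 1)
    (P P' : MultivectorField 𝕜 E p) (Q : MultivectorField 𝕜 E q) :
    schoutenInsertion h (P + P') Q = schoutenInsertion h P Q + schoutenInsertion h P' Q := by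
  cases p with
  | zero => simp [schoutenInsertion]
  | succ p =>
    refine Subtype.ext (funext fun ξ => AlternatingMap.ext fun α => ?_)
    change _ = (schoutenInsertion h P Q).1 ξ α + (schoutenInsertion h P' Q).1 ξ α
    simp only [schoutenInsertion_succ_apply, ← mul_add, ← Finset.sum_add_distrib, ← smul_add]
    rfl

theorem schoutenInsertion_smul_left {p q n : ℕ} (h : p + q = n + 1) (c : 𝕜)
    (P : MultivectorField 𝕜 E p) (Q : MultivectorField 𝕜 E q) :
    schoutenInsertion h (c • P) Q = c • schoutenInsertion h P Q := by
  cases p with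
  | zero => simp [schoutenInsertion]
  | succ p =>
    refine Subtype.ext (funext fun ξ => AlternatingMap.ext fun α => ?_)
    change _ = c * (schoutenInsertion h P Q).1 ξ α
    simp only [schoutenInsertion_succ_apply]
    rw [mul_left_comm]
    congr 1
    rw [Finset.mul_sum]
    refine Finset.sum_congr rfl fun σ _ => ?_
    rw [mul_smul_comm]
    rfl

/-! ### Poisson structures -/

/-- A bivector field `Λ` is a Poisson structure if `[Λ, Λ]_S = 0`. -/
def IsPoisson (Λ : MultivectorField 𝕜 E 2) : Prop :=
  schouten (show 2 + 2 = 3 + 1 from rfl) Λ Λ = 0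

/-- A bi-Hamiltonian structure: all linear combinations of `Λ₁` and `Λ₂` are Poisson structures. -/
def IsBiHamiltonian (Λ₁ Λ₂ : MultivectorField 𝕜 E 2) : Prop :=
  ∀ a b : 𝕜, IsPoisson (a • Λ₁ + b • Λ₂)

/-- The Poisson coboundary operator `δ_Λ P = (-1) ^ (p - 1) [Λ, P]_S` on `𝔛^p(E)`. (The exponent is
written as `p + 1`, which has the same parity.) -/
noncomputable def poissonDifferential (Λ : MultivectorField 𝕜 E 2) (p : ℕ) :
    MultivectorField 𝕜 E p →ₗ[𝕜] MultivectorField 𝕜 E (p + 1) where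
  toFun P := (-1 : 𝕜) ^ (p + 1) • schouten (show 2 + p = p + 1 + 1 by omega) Λ P
  map_add' P P' := by
    simp only [schouten, schoutenInsertion_add_left, schoutenInsertion_add_right]
    module
  map_smul' c P := by
    simp only [schouten, schoutenInsertion_smul_left, schoutenInsertion_smul_right,
      RingHom.id_apply]
    module

/-- The bi-Hamiltonian cohomology complex of `(Λ₁, Λ₂)`: the kernel of `δ_{Λ₁}` with the
differential `δ_{Λ₂}`. -/
noncomputable abbrev biHamiltonianComplex {Λ₁ Λ₂ : MultivectorField 𝕜 E 2}
    (h : AnticommutingDifferentials (C := fun p => MultivectorField 𝕜 E p)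
      (poissonDifferential Λ₁) (poissonDifferential Λ₂)) :=
  kernelComplex h

/-- The Poisson bracket `{f, h} = Λ (df, dh)`. -/
noncomputable def poissonBracket (Λ : MultivectorField 𝕜 E 2) (f h : SmoothFunction 𝕜 E) :
    SmoothFunction 𝕜 E :=
  ⟨fun ξ => Λ.1 ξ fun i => (![fderiv 𝕜 f.1, fderiv 𝕜 h.1] i) ξ, by
    refine multivector_contDiff_apply Λ _ fun i => ?_
    fin_cases i
    · exact (smoothFunction_contDiff f).fderiv_right (by simp)
    · exact (smoothFunction_contDiff h).fderiv_right (by simp)⟩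

theorem poissonBracket_apply (Λ : MultivectorField 𝕜 E 2) (f h : SmoothFunction 𝕜 E) (ξ : E) :
    (poissonBracket Λ f h).1 ξ = Λ.1 ξ ![fderiv 𝕜 f.1 ξ, fderiv 𝕜 h.1 ξ] := by
  refine congrArg (Λ.1 ξ) (funext fun i => ?_)
  fin_cases i <;> rfl

end Geometry

/-! ### Lie-Poisson structures -/

section LiePoisson

variable {𝕜 : Type u} [RCLike 𝕜] {g : Type v} [NormedAddCommGroup g] [NormedSpace 𝕜 g]

/-- The linear function `l_x(ξ) = ⟨x, ξ⟩` on `g^*`, as an element of the dual of `g^*`. -/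
noncomputable def linFun (x : g) : StrongDual 𝕜 (StrongDual 𝕜 g) :=
  NormedSpace.inclusionInDoubleDual 𝕜 g x

theorem linFun_apply (x : g) (ξ : StrongDual 𝕜 g) : linFun x ξ = ξ x := rfl

/-- The linear function `l_x` as a smooth function. -/
noncomputable def linSmooth (x : g) : SmoothFunction 𝕜 (StrongDual 𝕜 g) :=
  ⟨fun ξ => linFun x ξ,
    (ContinuousLinearMap.contDiff (linFun (𝕜 := 𝕜) x) : ContDiff 𝕜 ∞ fun ξ => linFun x ξ)⟩

/-- The differential of `l_x` at any point is `l_x` itself. -/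
theorem fderiv_linSmooth (x : g) (ξ : StrongDual 𝕜 g) :
    fderiv 𝕜 (linSmooth x).1 ξ = linFun x :=
  ContinuousLinearMap.fderiv (linFun (𝕜 := 𝕜) x)

theorem finrank_strongDual_eq (F : Type v) [NormedAddCommGroup F] [NormedSpace 𝕜 F]
    [FiniteDimensional 𝕜 F] : Module.finrank 𝕜 (StrongDual 𝕜 F) = Module.finrank 𝕜 F :=
  (LinearMap.toContinuousLinearMap (𝕜 := 𝕜) (E := F) (F' := 𝕜)).symm.finrank_eq.trans
    Subspace.dual_finrank_eq

variable [FiniteDimensional 𝕜 g]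

theorem inclusionInDoubleDual_bijective :
    Function.Bijective (NormedSpace.inclusionInDoubleDual 𝕜 g).toLinearMap := by
  have hinj : Function.Injective (NormedSpace.inclusionInDoubleDual 𝕜 g).toLinearMap :=
    (NormedSpace.inclusionInDoubleDualLi (E := g) 𝕜).injective
  have hfin : Module.finrank 𝕜 g = Module.finrank 𝕜 (StrongDual 𝕜 (StrongDual 𝕜 g)) :=
    (finrank_strongDual_eq g).symm.trans (finrank_strongDual_eq (StrongDual 𝕜 g)).symm
  have h := LinearMap.injective_iff_surjective_of_finrank_eq_finrank (K := 𝕜) (V := g)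
    (V₂ := StrongDual 𝕜 (StrongDual 𝕜 g)) hfin
    (f := (NormedSpace.inclusionInDoubleDual 𝕜 g).toLinearMap)
  exact ⟨hinj, h.1 hinj⟩

variable (𝕜 g) in
/-- The identification `x ↦ l_x` of `g` with the dual of `g^*`. -/
noncomputable def linFunEquiv : g ≃ₗ[𝕜] StrongDual 𝕜 (StrongDual 𝕜 g) :=
  LinearEquiv.ofBijective (NormedSpace.inclusionInDoubleDual 𝕜 g).toLinearMap
    inclusionInDoubleDual_bijective

/-- The Lie-Poisson structure on `g^*` of the Lie algebra `(g, π)`: the bivector field with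
`Π(dl_x, dl_y) = l_{[x, y]}`, see `liePoisson_apply`. -/
noncomputable def liePoisson (π : LieStructure 𝕜 g) : MultivectorField 𝕜 (StrongDual 𝕜 g) 2 :=
  ⟨fun ξ =>
    { toFun := fun α => ξ (π.br ((linFunEquiv 𝕜 g).symm (α 0)) ((linFunEquiv 𝕜 g).symm (α 1)))
      map_update_add' := fun α i x y => by
        fin_cases i <;> simp
      map_update_smul' := fun α i c x => by
        fin_cases i <;> simp
      map_eq_zero_of_eq' := fun α i j h hij => by
        have h01 : α 0 = α 1 := by
          fin_cases i <;> fin_cases j <;> simp_all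
        rw [h01, π.self_eq_zero, map_zero] },
    fun α => (linFun (𝕜 := 𝕜) _).contDiff⟩

theorem liePoisson_apply (π : LieStructure 𝕜 g) (ξ : StrongDual 𝕜 g) (x y : g) :
    (liePoisson π).1 ξ ![linFun x, linFun y] = linFun (π.br x y) ξ := by
  have h (z : g) : (linFunEquiv 𝕜 g).symm (linFun z) = z := (linFunEquiv 𝕜 g).symm_apply_apply z
  change ξ (π.br ((linFunEquiv 𝕜 g).symm (linFun x)) ((linFunEquiv 𝕜 g).symm (linFun y))) = _
  rw [h, h, linFun_apply]

theorem poissonBracket_liePoisson_apply (π : LieStructure 𝕜 g) (x : g)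
    (f : SmoothFunction 𝕜 (StrongDual 𝕜 g)) (ξ : StrongDual 𝕜 g) :
    (poissonBracket (liePoisson π) (linSmooth x) f).1 ξ =
      ξ (π.br x ((linFunEquiv 𝕜 g).symm (fderiv 𝕜 f.1 ξ))) := by
  have h : (linFunEquiv 𝕜 g).symm (linFun x) = x := (linFunEquiv 𝕜 g).symm_apply_apply x
  rw [poissonBracket_apply, fderiv_linSmooth]
  change ξ (π.br ((linFunEquiv 𝕜 g).symm (linFun x)) _) = _
  rw [h]
  rfl

/-- The representation `ρ(x) f = {l_x, f}` of `(g, π)` on `C^∞(g^*)`. -/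
noncomputable def liePoissonRep (π : LieStructure 𝕜 g) :
    g →ₗ[𝕜] Module.End 𝕜 (SmoothFunction 𝕜 (StrongDual 𝕜 g)) :=
  LinearMap.mk₂ 𝕜 (fun x f => poissonBracket (liePoisson π) (linSmooth x) f)
    (fun x y f => Subtype.ext (funext fun ξ => by
      change _ = (poissonBracket (liePoisson π) (linSmooth x) f).1 ξ +
        (poissonBracket (liePoisson π) (linSmooth y) f).1 ξ
      simp only [poissonBracket_liePoisson_apply, map_add, LinearMap.add_apply]))
    (fun c x f => Subtype.ext (funext fun ξ => by
      change _ = c * (poissonBracket (liePoisson π) (linSmooth x) f).1 ξ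
      simp only [poissonBracket_liePoisson_apply, map_smul, LinearMap.smul_apply, smul_eq_mul]))
    (fun x f h => Subtype.ext (funext fun ξ => by
      have hd : fderiv 𝕜 (f + h).1 ξ = fderiv 𝕜 f.1 ξ + fderiv 𝕜 h.1 ξ :=
        fderiv_add (smoothFunction_differentiableAt f ξ) (smoothFunction_differentiableAt h ξ)
      change _ = (poissonBracket (liePoisson π) (linSmooth x) f).1 ξ +
        (poissonBracket (liePoisson π) (linSmooth x) h).1 ξ
      simp only [poissonBracket_liePoisson_apply, hd, map_add]))
    (fun c x f => Subtype.ext (funext fun ξ => by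
      have hd : fderiv 𝕜 (c • f).1 ξ = c • fderiv 𝕜 f.1 ξ :=
        fderiv_const_smul (smoothFunction_differentiableAt f ξ) c
      change _ = c * (poissonBracket (liePoisson π) (linSmooth x) f).1 ξ
      simp only [poissonBracket_liePoisson_apply, hd, map_smul, smul_eq_mul]))

end LiePoisson

/-! Since g is finite dimensional, the covectors on g* are exactly the l_x. A p-vector field on g*
is therefore the same thing as an alternating map on g with values in smooth functions
(`multivectorCochainEquiv`). Under this identification the Poisson differential of a Lie–Poisson
structure is the Chevalley–Eilenberg differential (`multivectorCochainEquiv_poissonDifferential`):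
inserting P into Π gives the action part, and inserting Π into P gives the bracket part, because the
components of Π are linear functions.

Everything else is proved on the cochain side and carried back, so no graded Jacobi identity for the
Schouten bracket is needed. Cartan's formula and induction on the degree give d² = 0
(`ceDifferential_ceDifferential`). The differential is additive in the pair (bracket, action), and
the sum of the two structures is again a Lie algebra with a representation, so expanding (d₁ + d₂)²
= 0 gives anticommutation. A Lie–Poisson bivector is the coboundary of x ↦ l_x, so [Π, Π] = 0 is
another case of d² = 0. This covers every combination of Π₁ and Π₂, since each is the Lie–Poisson
structure of the combined bracket. The isomorphism of complexes is the degreewise identification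
restricted to kernels. -/

section Cartan

/-! ### Cartan calculus for Chevalley–Eilenberg cochains. -/

variable {𝕜 : Type u} {g : Type v} [Field 𝕜] [AddCommGroup g] [Module 𝕜 g]
  {V : Type w} [AddCommGroup V] [Module 𝕜 V]

theorem LieStructure.br_br (π : LieStructure 𝕜 g) (x y z : g) :
    π.br (π.br x y) z = π.br x (π.br y z) - π.br y (π.br x z) := by
  have h := π.jacobi x y z
  rw [π.br_swap x (π.br y z), π.br_swap x z, map_neg, LinearMap.neg_apply,
    π.br_swap y (π.br x z)] at h
  rw [← sub_eq_zero, ← h]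
  abel

theorem AlternatingMap.ext_curryLeft {n : ℕ} {f f' : g [⋀^Fin (n + 1)]→ₗ[𝕜] V}
    (h : ∀ x, f.curryLeft x = f'.curryLeft x) : f = f' := by
  ext x
  have h1 := DFunLike.congr_fun (h (x 0)) (Fin.tail x)
  simp only [AlternatingMap.curryLeft_apply_apply] at h1
  rwa [Matrix.vecCons, Fin.cons_self_tail] at h1

theorem AlternatingMap.curryLeft_curryLeft_swap {n : ℕ} (f : g [⋀^Fin (n + 2)]→ₗ[𝕜] V) (x y : g) :
    (f.curryLeft x).curryLeft y = -(f.curryLeft y).curryLeft x := by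
  have h := f.curryLeft_same (x + y)
  simp only [map_add, LinearMap.add_apply, AlternatingMap.curryLeft_add,
    AlternatingMap.curryLeft_same, zero_add, add_zero] at h
  exact eq_neg_of_add_eq_zero_left (by rwa [add_comm])

theorem AlternatingMap.alternatizeUncurryFin_zero_curryLeft (G : g →ₗ[𝕜] g [⋀^Fin 0]→ₗ[𝕜] V)
    (x : g) : (alternatizeUncurryFin G).curryLeft x = G x := by
  ext v
  simp [alternatizeUncurryFin_apply]

/-- The contraction of the alternatization with a vector, `i_x (A G) = G x - A (i_x ∘ G)`. -/
theorem AlternatingMap.alternatizeUncurryFin_curryLeft_apply {n : ℕ}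
    (G : g →ₗ[𝕜] g [⋀^Fin (n + 1)]→ₗ[𝕜] V) (x : g) :
    (alternatizeUncurryFin G).curryLeft x =
      G x - alternatizeUncurryFin ((AlternatingMap.curryLeftLinearMap ∘ₗ G).flip x) := by
  ext v
  simp only [curryLeft_apply_apply, alternatizeUncurryFin_apply, sub_apply]
  -- The term that feeds x to G is G x; in all others the index is shifted by one, whence the minus
  -- sign.
  rw [Fin.sum_univ_succ, sub_eq_add_neg, ← Finset.sum_neg_distrib]
  congr 1
  · simp
  · refine Finset.sum_congr rfl fun i _ => ?_
    simp only [Fin.val_succ, pow_succ, mul_neg, mul_one, neg_smul, Matrix.cons_val_succ]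
    congr 2
    simp only [LinearMap.flip_apply, LinearMap.comp_apply, curryLeftLinearMap_apply,
      curryLeft_apply_apply]
    congr 1
    funext j
    refine Fin.cases ?_ (fun j => ?_) j <;> simp [Fin.removeNth]

/-- Insertion of the derivation `D` into an alternating map,
`(D ⬝ f) (x₁, …, xₙ) = ∑ i, f (x₁, …, D xᵢ, …, xₙ)`. -/
def AlternatingMap.derivationInsert (D : Module.End 𝕜 g) : (k : ℕ) →
    (g [⋀^Fin k]→ₗ[𝕜] V) →ₗ[𝕜] (g [⋀^Fin k]→ₗ[𝕜] V)
  | 0 => 0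
  | _ + 1 => alternatizeUncurryFinLM ∘ₗ LinearMap.lcomp 𝕜 _ D ∘ₗ curryLeftLinearMap

/-- Leibniz rule: D hits either the slot of x or one of the others. The minus sign of the
contraction formula cancels against the one from exchanging two contractions. -/
theorem AlternatingMap.derivationInsert_curryLeft (D : Module.End 𝕜 g) (n : ℕ)
    (f : g [⋀^Fin (n + 1)]→ₗ[𝕜] V) (x : g) :
    (derivationInsert D (n + 1) f).curryLeft x =
      f.curryLeft (D x) + derivationInsert D n (f.curryLeft x) := by
  change (alternatizeUncurryFin (f.curryLeft ∘ₗ D)).curryLeft x = _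
  cases n with
  | zero => rw [alternatizeUncurryFin_zero_curryLeft]; exact (add_zero _).symm
  | succ n =>
    rw [alternatizeUncurryFin_curryLeft_apply, sub_eq_add_neg]
    congr 1
    change _ = alternatizeUncurryFinLM ((f.curryLeft x).curryLeft ∘ₗ D)
    rw [← alternatizeUncurryFinLM_apply, ← map_neg]
    congr 1
    refine LinearMap.ext fun y => ?_
    exact (f.curryLeft_curryLeft_swap _ _).symm

/-- The Lie derivative of cochains along `x`. -/
def ceLieDerivative (π : LieStructure 𝕜 g) (ρ : g →ₗ[𝕜] Module.End 𝕜 V) (x : g) (n : ℕ) :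
    (g [⋀^Fin n]→ₗ[𝕜] V) →ₗ[𝕜] (g [⋀^Fin n]→ₗ[𝕜] V) :=
  (ρ x).compAlternatingMapₗ 𝕜 - AlternatingMap.derivationInsert (π.br x) n

/-- Acting on values commutes with contraction, so only the Leibniz term survives. This relation
drives the inductions on the degree below. -/
theorem ceLieDerivative_curryLeft (π : LieStructure 𝕜 g) (ρ : g →ₗ[𝕜] Module.End 𝕜 V) (x y : g)
    {n : ℕ} (f : g [⋀^Fin (n + 1)]→ₗ[𝕜] V) :
    (ceLieDerivative π ρ x (n + 1) f).curryLeft y =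
      ceLieDerivative π ρ x n (f.curryLeft y) - f.curryLeft (π.br x y) := by
  have h := AlternatingMap.derivationInsert_curryLeft (π.br x) n f y
  have h1 : (ceLieDerivative π ρ x (n + 1) f).curryLeft y =
    (ρ x).compAlternatingMap (f.curryLeft y) -
      (AlternatingMap.derivationInsert (π.br x) (n + 1) f).curryLeft y := rfl
  rw [h1, h, ceLieDerivative, LinearMap.sub_apply, LinearMap.compAlternatingMapₗ_apply]
  abel

/-- In degree zero this is the representation property. After contraction with z the mixed terms
cancel, and the two double brackets left over combine by the Jacobi identity. -/
theorem ceLieDerivative_commutator {π : LieStructure 𝕜 g} {ρ : g →ₗ[𝕜] Module.End 𝕜 V}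
    (hρ : π.IsRepresentation ρ) (x y : g) (n : ℕ) (f : g [⋀^Fin n]→ₗ[𝕜] V) :
    ceLieDerivative π ρ x n (ceLieDerivative π ρ y n f) -
      ceLieDerivative π ρ y n (ceLieDerivative π ρ x n f) =
        ceLieDerivative π ρ (π.br x y) n f := by
  induction n with
  | zero =>
    ext v
    simp [ceLieDerivative, AlternatingMap.derivationInsert, hρ x y, Ring.lie_def]
  | succ n ih =>
    refine AlternatingMap.ext_curryLeft fun z => ?_
    have hs (a b : g [⋀^Fin (n + 1)]→ₗ[𝕜] V) :
        (a - b).curryLeft z = a.curryLeft z - b.curryLeft z := rfl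
    simp only [hs, ceLieDerivative_curryLeft, map_sub, ← ih (f.curryLeft z), π.br_br]
    abel

theorem ceActionPart_curryLeft (ρ : g →ₗ[𝕜] Module.End 𝕜 V) {n : ℕ}
    (f : g [⋀^Fin (n + 1)]→ₗ[𝕜] V) (x : g) :
    (ceActionPart ρ (n + 1) f).curryLeft x =
      (ρ x).compAlternatingMap f - ceActionPart ρ n (f.curryLeft x) :=
  AlternatingMap.alternatizeUncurryFin_curryLeft_apply _ x

theorem ceBracketPart_one_curryLeft [CharZero 𝕜] (π : LieStructure 𝕜 g)
    (f : g [⋀^Fin 1]→ₗ[𝕜] V) (x : g) :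
    (ceBracketPart π 1 f).curryLeft x = -AlternatingMap.derivationInsert (π.br x) 1 f := by
  ext v
  simp only [AlternatingMap.curryLeft_apply_apply, AlternatingMap.neg_apply]
  rw [ceBracketPart_succ_apply]
  simp [AlternatingMap.derivationInsert, AlternatingMap.alternatizeUncurryFin_apply]

/-- Pairs of positions that involve x produce the insertion of ad x; the remaining pairs form the
bracket part of the contracted cochain. -/
theorem ceBracketPart_curryLeft [CharZero 𝕜] (π : LieStructure 𝕜 g) {n : ℕ}
    (f : g [⋀^Fin (n + 1)]→ₗ[𝕜] V) (x : g) :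
    (ceBracketPart π (n + 1) f).curryLeft x =
      -AlternatingMap.derivationInsert (π.br x) (n + 1) f - ceBracketPart π n (f.curryLeft x) := by
  cases n with
  | zero =>
    rw [ceBracketPart_one_curryLeft]
    exact (sub_zero _).symm
  | succ n =>
    set A := AlternatingMap.alternatizeUncurryFinLM (R := 𝕜) (M := g) (N := V) (n := n + 1)
    have h2 : (2 : 𝕜) ≠ 0 := two_ne_zero
    have h1 : (ceBracketPart π (n + 2) f).curryLeft x = (-(2 : 𝕜)⁻¹) •
      (AlternatingMap.alternatizeUncurryFin (A ∘ₗ ceBracketAux π f)).curryLeft x := rfl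
    have h3 : (AlternatingMap.curryLeftLinearMap ∘ₗ A ∘ₗ ceBracketAux π f).flip x =
        -(f.curryLeft ∘ₗ π.br x) +
          AlternatingMap.alternatizeUncurryFinLM ∘ₗ ceBracketAux π (f.curryLeft x) := by
      refine LinearMap.ext fun a => ?_
      change (AlternatingMap.alternatizeUncurryFin (ceBracketAux π f a)).curryLeft x =
        -(f.curryLeft (π.br x a)) +
          AlternatingMap.alternatizeUncurryFinLM (ceBracketAux π (f.curryLeft x) a)
      rw [AlternatingMap.alternatizeUncurryFin_curryLeft_apply, sub_eq_add_neg]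
      congr 1
      · change f.curryLeft (π.br a x) = _
        rw [π.br_swap x a, map_neg]
      · rw [← AlternatingMap.alternatizeUncurryFinLM_apply, ← map_neg]
        congr 1
        refine LinearMap.ext fun b => ?_
        exact (f.curryLeft_curryLeft_swap _ _).symm
    rw [h1, AlternatingMap.alternatizeUncurryFin_curryLeft_apply, h3,
      AlternatingMap.alternatizeUncurryFin_add, ← AlternatingMap.alternatizeUncurryFinLM_apply,
      map_neg]
    change (-(2 : 𝕜)⁻¹) • (A (f.curryLeft ∘ₗ π.br x) - (-A (f.curryLeft ∘ₗ π.br x) + _)) =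
      -A (f.curryLeft ∘ₗ π.br x) - (-(2 : 𝕜)⁻¹) • _
    -- The vector x can sit in the outer or the inner alternated slot, with equal contributions; the
    -- factor 1/2 compensates for this.
    match_scalars <;> field_simp
    ring

/-- Cartan's formula in degree zero. -/
theorem ceDifferential_zero_curryLeft (π : LieStructure 𝕜 g) (ρ : g →ₗ[𝕜] Module.End 𝕜 V)
    (f : g [⋀^Fin 0]→ₗ[𝕜] V) (x : g) :
    (ceDifferential π ρ 0 f).curryLeft x = ceLieDerivative π ρ x 0 f := by
  ext v
  simp [ceDifferential, ceBracketPart, ceActionPart_apply, ceLieDerivative,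
    AlternatingMap.derivationInsert]

/-- Cartan's formula. -/
theorem ceDifferential_curryLeft [CharZero 𝕜] (π : LieStructure 𝕜 g)
    (ρ : g →ₗ[𝕜] Module.End 𝕜 V) {n : ℕ} (f : g [⋀^Fin (n + 1)]→ₗ[𝕜] V) (x : g) :
    (ceDifferential π ρ (n + 1) f).curryLeft x =
      ceLieDerivative π ρ x (n + 1) f - ceDifferential π ρ n (f.curryLeft x) := by
  have h : (ceDifferential π ρ (n + 1) f).curryLeft x =
    (ceActionPart ρ (n + 1) f).curryLeft x + (ceBracketPart π (n + 1) f).curryLeft x := rfl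
  rw [h, ceActionPart_curryLeft, ceBracketPart_curryLeft, ceLieDerivative, ceDifferential,
    LinearMap.sub_apply, LinearMap.compAlternatingMapₗ_apply, LinearMap.add_apply]
  abel

/-- Contracting with y and applying Cartan's formula reduces this to the commutator of Lie
derivatives and to one degree lower. -/
theorem ceDifferential_ceLieDerivative [CharZero 𝕜] {π : LieStructure 𝕜 g}
    {ρ : g →ₗ[𝕜] Module.End 𝕜 V} (hρ : π.IsRepresentation ρ) (x : g) (n : ℕ)
    (f : g [⋀^Fin n]→ₗ[𝕜] V) :
    ceDifferential π ρ n (ceLieDerivative π ρ x n f) =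
      ceLieDerivative π ρ x (n + 1) (ceDifferential π ρ n f) := by
  induction n with
  | zero =>
    refine AlternatingMap.ext_curryLeft fun y => ?_
    rw [ceLieDerivative_curryLeft]
    simp only [ceDifferential_zero_curryLeft]
    rw [← ceLieDerivative_commutator hρ, sub_sub_cancel]
  | succ n ih =>
    refine AlternatingMap.ext_curryLeft fun y => ?_
    rw [ceLieDerivative_curryLeft]
    simp only [ceDifferential_curryLeft, ceLieDerivative_curryLeft, map_sub, ih]
    rw [← ceLieDerivative_commutator hρ]
    abel

/-- By Cartan's formula, contraction with y turns d² f into [L_y, d] f + d² (i_y f): the first term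
vanishes by the previous lemma, the second by induction. -/
theorem ceDifferential_ceDifferential [CharZero 𝕜] {π : LieStructure 𝕜 g}
    {ρ : g →ₗ[𝕜] Module.End 𝕜 V} (hρ : π.IsRepresentation ρ) (n : ℕ)
    (f : g [⋀^Fin n]→ₗ[𝕜] V) :
    ceDifferential π ρ (n + 1) (ceDifferential π ρ n f) = 0 := by
  induction n with
  | zero =>
    refine AlternatingMap.ext_curryLeft fun y => ?_
    rw [ceDifferential_curryLeft, ceDifferential_zero_curryLeft,
      ceDifferential_ceLieDerivative hρ, sub_self]
    rfl
  | succ n ih =>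
    refine AlternatingMap.ext_curryLeft fun y => ?_
    rw [ceDifferential_curryLeft, ceDifferential_curryLeft, map_sub, ih,
      ceDifferential_ceLieDerivative hρ, sub_zero, sub_self]
    rfl

/-! ### Polarization -/

/-- The linear combination `a π₁ + b π₂` of the brackets of a compatible Lie algebra. -/
def CompatibleLieStructure.combination (L : CompatibleLieStructure 𝕜 g) (a b : 𝕜) :
    LieStructure 𝕜 g where
  br := a • L.fst.br + b • L.snd.br
  self_eq_zero x := by simp [L.fst.self_eq_zero, L.snd.self_eq_zero]
  jacobi x y z := by
    -- The Jacobiator is quadratic in the bracket: a² and b² multiply the two Jacobi identities, ab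
    -- the mixed one.
    have h1 := congrArg ((a * a) • ·) (L.fst.jacobi x y z)
    have h2 := congrArg ((b * b) • ·) (L.snd.jacobi x y z)
    have h3 := congrArg ((a * b) • ·) (L.compatible x y z)
    simp only [smul_zero] at h1 h2 h3
    have h := congrArg₂ (· + ·) (congrArg₂ (· + ·) h1 h2) h3
    simp only [add_zero] at h
    rw [← h]
    simp only [LinearMap.add_apply, LinearMap.smul_apply, map_add, map_smul]
    module

/-- Two representations, of the two Lie algebras of a compatible Lie algebra, whose sum is a
representation of the sum of the two, form a representation of the compatible Lie algebra. -/
theorem CompatibleLieStructure.isRepresentation_of_add {L : CompatibleLieStructure 𝕜 g}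
    {ρ μ : g →ₗ[𝕜] Module.End 𝕜 V} (hρ : L.fst.IsRepresentation ρ)
    (hμ : L.snd.IsRepresentation μ) (h : (L.combination 1 1).IsRepresentation (ρ + μ)) :
    L.IsRepresentation ρ μ where
  fst := hρ
  snd := hμ
  mixed x y := by
    have h1 := h x y
    have h2 := hρ x y
    have h3 := hμ x y
    simp only [CompatibleLieStructure.combination, one_smul, LinearMap.add_apply, map_add,
      h2, h3, Ring.lie_def, add_mul, mul_add] at h1
    simp only [Ring.lie_def]
    rw [← sub_eq_zero] at h1 ⊢
    rw [← h1]
    abel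

/-- This additivity is what allows polarizing d² = 0. -/
theorem ceDifferential_add (π₁ π₂ π : LieStructure 𝕜 g) (hπ : π.br = π₁.br + π₂.br)
    (ρ μ : g →ₗ[𝕜] Module.End 𝕜 V) (n : ℕ) (f : g [⋀^Fin n]→ₗ[𝕜] V) :
    ceDifferential π (ρ + μ) n f = ceDifferential π₁ ρ n f + ceDifferential π₂ μ n f := by
  have h1 : ceActionPart (ρ + μ) n f = ceActionPart ρ n f + ceActionPart μ n f := by
    ext x
    simp [ceActionPart_apply, Finset.sum_add_distrib]
  have h2 : ceBracketPart π n f = ceBracketPart π₁ n f + ceBracketPart π₂ n f := by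
    cases n with
    | zero => exact (add_zero _).symm
    | succ n =>
      have h3 : ceBracketAux π f = ceBracketAux π₁ f + ceBracketAux π₂ f := by
        ext x y v
        simp [ceBracketAux, hπ]
      change (-(2 : 𝕜)⁻¹) • AlternatingMap.alternatizeUncurryFin
        (AlternatingMap.alternatizeUncurryFinLM ∘ₗ ceBracketAux π f) = _
      rw [h3, LinearMap.comp_add, AlternatingMap.alternatizeUncurryFin_add, smul_add]
      rfl
  simp only [ceDifferential, LinearMap.add_apply, h1, h2]
  abel

/-- The cross terms of (d₁ + d₂)² = 0 are the anticommutator. -/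
theorem ceDifferential_anticommutingDifferentials [CharZero 𝕜] {L : CompatibleLieStructure 𝕜 g}
    {ρ μ : g →ₗ[𝕜] Module.End 𝕜 V} (hρ : L.fst.IsRepresentation ρ)
    (hμ : L.snd.IsRepresentation μ) (h : (L.combination 1 1).IsRepresentation (ρ + μ)) :
    AnticommutingDifferentials (C := fun n => g [⋀^Fin n]→ₗ[𝕜] V)
      (ceDifferential L.fst ρ) (ceDifferential L.snd μ) where
  sq_fst := ceDifferential_ceDifferential hρ
  sq_snd := ceDifferential_ceDifferential hμ
  anticomm n f := by
    have h1 := ceDifferential_ceDifferential h n f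
    have hb : (L.combination 1 1).br = L.fst.br + L.snd.br := by
      simp [CompatibleLieStructure.combination]
    simp only [ceDifferential_add L.fst L.snd _ hb, map_add,
      ceDifferential_ceDifferential hρ, ceDifferential_ceDifferential hμ] at h1
    simpa [add_comm] using h1

end Cartan

/-! ### Alternatization of maps that are already alternating in most variables. -/

section Alternatization

variable {R : Type*} {M N : Type*} [CommRing R] [AddCommGroup M] [AddCommGroup N] [Module R M]
  [Module R N] {n : ℕ}

/-- A permutation of `Fin (n + 1)` is given by the image `i` of `0` and a permutation of the
remaining elements. -/
theorem Fin.bijective_cycleRange_symm_mul_decomposeFin (n : ℕ) :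
    Function.Bijective fun p : Fin (n + 1) × Equiv.Perm (Fin n) =>
      (p.1.cycleRange.symm * Equiv.Perm.decomposeFin.symm (0, p.2) : Equiv.Perm (Fin (n + 1))) := by
  rw [Fintype.bijective_iff_injective_and_card]
  refine ⟨?_, by simp [Fintype.card_perm, Nat.factorial_succ]⟩
  rintro ⟨i, e⟩ ⟨i', e'⟩ h
  have hi : i = i' := by simpa using DFunLike.congr_fun h 0
  subst hi
  simpa using h

/-- Expansion of the alternatization of `f` along the first variable of `f`. -/
theorem MultilinearMap.alternatization_apply_succ
    (f : MultilinearMap R (fun _ : Fin (n + 1) => M) N) (v : Fin (n + 1) → M) :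
    alternatization f v =
      ∑ i : Fin (n + 1), (-1) ^ (i : ℕ) • alternatization (f.curryLeft (v i)) (i.removeNth v) := by
  rw [alternatization_apply,
    ← (Equiv.ofBijective _ (Fin.bijective_cycleRange_symm_mul_decomposeFin n)).sum_comp,
    Fintype.sum_prod_type]
  refine Finset.sum_congr rfl fun i _ => ?_
  rw [alternatization_apply, Finset.smul_sum]
  refine Finset.sum_congr rfl fun e _ => ?_
  have hs : Equiv.Perm.sign (i.cycleRange.symm * Equiv.Perm.decomposeFin.symm (0, e)) =
      (-1) ^ (i : ℕ) * Equiv.Perm.sign e := by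
    rw [Equiv.Perm.sign_mul, Equiv.Perm.decomposeFin.symm_sign, if_pos rfl, one_mul,
      Equiv.Perm.sign_symm, Fin.sign_cycleRange]
  have hv : (fun j => v ((i.cycleRange.symm * Equiv.Perm.decomposeFin.symm (0, e)) j)) =
      (Fin.cons (v i) fun j => i.removeNth v (e j) : Fin (n + 1) → M) := by
    funext j
    refine Fin.cases ?_ (fun j => ?_) j <;> simp [Fin.removeNth]
  simp only [Equiv.ofBijective_apply, hs, mul_smul, domDomCongr_apply, hv, curryLeft_apply]
  rw [Units.smul_def ((-1) ^ (i : ℕ))]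
  simp

/-- The n! permutations of the tail contribute equally. This converts the sum over all permutations
in `schoutenInsertion` into a sum over the choice of the distinguished argument. -/
theorem MultilinearMap.alternatization_eq_of_apply_head
    (f : MultilinearMap R (fun _ : Fin (n + 1) => M) N) (G : M →ₗ[R] M [⋀^Fin n]→ₗ[R] N)
    (h : ∀ v, f v = G (v 0) (Fin.tail v)) :
    alternatization f = n.factorial • AlternatingMap.alternatizeUncurryFin G := by
  ext v
  rw [alternatization_apply_succ, AlternatingMap.smul_apply,
    AlternatingMap.alternatizeUncurryFin_apply, Finset.smul_sum]
  refine Finset.sum_congr rfl fun i _ => ?_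
  have h1 : MultilinearMap.curryLeft (M := fun _ => M) f (v i) = (G (v i)).toMultilinearMap := by
    ext w
    simp [h]
  rw [h1]
  erw [AlternatingMap.coe_alternatization]
  rw [AlternatingMap.smul_apply, Fintype.card_fin, smul_comm]

theorem MultilinearMap.alternatization_eq_of_apply_head_head
    (f : MultilinearMap R (fun _ : Fin (n + 2) => M) N) (G : M →ₗ[R] M →ₗ[R] M [⋀^Fin n]→ₗ[R] N)
    (h : ∀ v, f v = G (v 0) (v 1) (Fin.tail (Fin.tail v))) :
    alternatization f = n.factorial • AlternatingMap.alternatizeUncurryFin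
      (AlternatingMap.alternatizeUncurryFinLM ∘ₗ G) := by
  ext v
  rw [alternatization_apply_succ, AlternatingMap.smul_apply,
    AlternatingMap.alternatizeUncurryFin_apply, Finset.smul_sum]
  refine Finset.sum_congr rfl fun i _ => ?_
  have h1 := alternatization_eq_of_apply_head
    (MultilinearMap.curryLeft (M := fun _ => M) f (v i)) (G (v i)) fun w => by
      simp [h]
  rw [h1, AlternatingMap.smul_apply, smul_comm]
  rfl

/-- A cyclic rotation, of sign (-1)^n, brings the distinguished last variable to the front. -/
theorem MultilinearMap.alternatization_eq_of_apply_last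
    (f : MultilinearMap R (fun _ : Fin (n + 1) => M) N) (G : M →ₗ[R] M [⋀^Fin n]→ₗ[R] N)
    (h : ∀ v, f v = G (v (Fin.last n)) (Fin.init v)) :
    alternatization f =
      (-1 : ℤ) ^ n • n.factorial • AlternatingMap.alternatizeUncurryFin G := by
  have h1 := alternatization_eq_of_apply_head (f.domDomCongr (finRotate (n + 1))) G fun v => by
    rw [domDomCongr_apply, h]
    congr 2
    · simp
    · funext i
      simp [Fin.init, Fin.tail]
  rw [← h1]
  ext v
  rw [AlternatingMap.smul_apply, alternatization_apply, alternatization_apply, Finset.smul_sum,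
    ← Equiv.sum_comp (Equiv.mulRight (finRotate (n + 1)))]
  refine Finset.sum_congr rfl fun σ _ => ?_
  simp [Equiv.Perm.sign_mul, mul_comm (Equiv.Perm.sign σ), mul_smul, Units.smul_def]

end Alternatization

/-! ### Pointwise evaluation of smooth functions. -/

section SmoothFunction

variable {𝕜 : Type u} [RCLike 𝕜] {E : Type v} [NormedAddCommGroup E] [NormedSpace 𝕜 E]

theorem smoothFunction_sum_apply {ι : Type*} (s : Finset ι)
    (f : ι → SmoothFunction 𝕜 E) (ξ : E) :
    (∑ i ∈ s, f i).1 ξ = ∑ i ∈ s, (f i).1 ξ :=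
  map_sum (LinearMap.proj ξ ∘ₗ (SmoothFunction 𝕜 E).subtype) f s

theorem smoothFunction_zsmul_apply (c : ℤ) (f : SmoothFunction 𝕜 E)
    (ξ : E) : (c • f).1 ξ = c • f.1 ξ :=
  map_zsmul (LinearMap.proj ξ ∘ₗ (SmoothFunction 𝕜 E).subtype) c f

end SmoothFunction

/-! ### The coadjoint action and the Lie–Poisson representation. -/

section LiePoissonCochain

variable {𝕜 : Type u} [RCLike 𝕜] {g : Type v} [NormedAddCommGroup g] [NormedSpace 𝕜 g]
  [FiniteDimensional 𝕜 g]

/-- The coadjoint action of `x`, as the linear vector field `ξ ↦ ξ ∘ ad x` on `g^*`. -/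
noncomputable def LieStructure.coadjoint (π : LieStructure 𝕜 g) (x : g) :
    StrongDual 𝕜 g →L[𝕜] StrongDual 𝕜 g :=
  (ContinuousLinearMap.compL 𝕜 g g 𝕜).flip (LinearMap.toContinuousLinearMap (π.br x))

theorem LieStructure.coadjoint_apply (π : LieStructure 𝕜 g) (x y : g) (ξ : StrongDual 𝕜 g) :
    π.coadjoint x ξ y = ξ (π.br x y) := rfl

theorem apply_linFunEquiv_symm (α : StrongDual 𝕜 (StrongDual 𝕜 g)) (ξ : StrongDual 𝕜 g) :
    ξ ((linFunEquiv 𝕜 g).symm α) = α ξ :=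
  DFunLike.congr_fun ((linFunEquiv 𝕜 g).apply_symm_apply α) ξ

/-- The Hamiltonian vector field of l_x is the linear coadjoint field, so brackets with l_x become
directional derivatives. -/
theorem liePoissonRep_apply (π : LieStructure 𝕜 g) (x : g)
    (f : SmoothFunction 𝕜 (StrongDual 𝕜 g)) (ξ : StrongDual 𝕜 g) :
    (liePoissonRep π x f).1 ξ = fderiv 𝕜 f.1 ξ (π.coadjoint x ξ) := by
  rw [← apply_linFunEquiv_symm (fderiv 𝕜 f.1 ξ)]
  exact poissonBracket_liePoisson_apply π x f ξ

theorem fderiv_liePoissonRep (π : LieStructure 𝕜 g) (x : g)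
    (f : SmoothFunction 𝕜 (StrongDual 𝕜 g)) (ξ v : StrongDual 𝕜 g) :
    fderiv 𝕜 (liePoissonRep π x f).1 ξ v =
      fderiv 𝕜 (fderiv 𝕜 f.1) ξ v (π.coadjoint x ξ) + fderiv 𝕜 f.1 ξ (π.coadjoint x v) := by
  have hf : DifferentiableAt 𝕜 (fderiv 𝕜 f.1) ξ :=
    (((smoothFunction_contDiff f).fderiv_right (m := ∞) (by simp)).differentiable (by simp)) ξ
  have h : (liePoissonRep π x f).1 = fun ξ => fderiv 𝕜 f.1 ξ (π.coadjoint x ξ) :=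
    funext fun ξ => liePoissonRep_apply π x f ξ
  rw [h, fderiv_clm_apply hf (π.coadjoint x).differentiableAt]
  simp [add_comm]

/-- In the commutator of two directional derivatives the second-order terms cancel by symmetry of
the second derivative; the first-order terms match by the Jacobi identity. -/
theorem liePoissonRep_isRepresentation (π : LieStructure 𝕜 g) :
    π.IsRepresentation (liePoissonRep π) := by
  intro x y
  refine LinearMap.ext fun f => Subtype.ext (funext fun ξ => ?_)
  have hs : fderiv 𝕜 (fderiv 𝕜 f.1) ξ (π.coadjoint x ξ) (π.coadjoint y ξ) =
      fderiv 𝕜 (fderiv 𝕜 f.1) ξ (π.coadjoint y ξ) (π.coadjoint x ξ) :=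
    (smoothFunction_contDiff f).contDiffAt.isSymmSndFDerivAt
      (by rw [minSmoothness_of_isRCLikeNormedField]; exact WithTop.coe_le_coe.2 le_top) _ _
  -- Without the customary minus sign, `coadjoint` reverses commutators; the chain rule reverses
  -- them once more.
  have hb : π.coadjoint (π.br x y) ξ =
      π.coadjoint y (π.coadjoint x ξ) - π.coadjoint x (π.coadjoint y ξ) := by
    ext z
    simp [LieStructure.coadjoint_apply, π.br_br x y z]
  change _ = (liePoissonRep π x (liePoissonRep π y f)).1 ξ -
    (liePoissonRep π y (liePoissonRep π x f)).1 ξ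
  simp only [liePoissonRep_apply π _ _ ξ, fderiv_liePoissonRep, hs, hb, map_sub]
  ring

theorem liePoissonRep_combination (L : CompatibleLieStructure 𝕜 g) (a b : 𝕜) :
    liePoissonRep (L.combination a b) = a • liePoissonRep L.fst + b • liePoissonRep L.snd := by
  refine LinearMap.ext fun x => LinearMap.ext fun f => Subtype.ext (funext fun ξ => ?_)
  change _ = a * (liePoissonRep L.fst x f).1 ξ + b * (liePoissonRep L.snd x f).1 ξ
  have h : (L.combination a b).coadjoint x ξ =
      a • L.fst.coadjoint x ξ + b • L.snd.coadjoint x ξ := by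
    ext z
    simp [LieStructure.coadjoint_apply, CompatibleLieStructure.combination]
  simp only [liePoissonRep_apply, h, map_add, map_smul, smul_eq_mul]

theorem liePoisson_combination (L : CompatibleLieStructure 𝕜 g) (a b : 𝕜) :
    liePoisson (L.combination a b) = a • liePoisson L.fst + b • liePoisson L.snd := by
  refine Subtype.ext (funext fun ξ => AlternatingMap.ext fun α => ?_)
  change ξ _ = a * ξ _ + b * ξ _
  simp [CompatibleLieStructure.combination]

/-! ### Multivector fields as cochains; Schouten brackets with a Lie–Poisson structure. -/

variable (𝕜 g) in
/-- The identification of the `p`-vector fields on `g^*` with the cochains of `g` with values in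
the smooth functions on `g^*`, `P ↦ ((x₁, …, x_p) ↦ P (dl_{x₁}, …, dl_{x_p}))`. -/
noncomputable def multivectorCochainEquiv (p : ℕ) :
    MultivectorField 𝕜 (StrongDual 𝕜 g) p ≃ₗ[𝕜]
      (g [⋀^Fin p]→ₗ[𝕜] SmoothFunction 𝕜 (StrongDual 𝕜 g)) where
  toFun P :=
    { toFun := fun x => ⟨fun ξ => (P.1 ξ).compLinearMap (linFunEquiv 𝕜 g).toLinearMap x, P.2 _⟩
      map_update_add' := fun x i a b => Subtype.ext (funext fun ξ =>
        ((P.1 ξ).compLinearMap (linFunEquiv 𝕜 g).toLinearMap).map_update_add' x i a b)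
      map_update_smul' := fun x i c a => Subtype.ext (funext fun ξ =>
        ((P.1 ξ).compLinearMap (linFunEquiv 𝕜 g).toLinearMap).map_update_smul' x i c a)
      map_eq_zero_of_eq' := fun x i j h hij => Subtype.ext (funext fun ξ =>
        ((P.1 ξ).compLinearMap (linFunEquiv 𝕜 g).toLinearMap).map_eq_zero_of_eq x h hij) }
  map_add' P Q := rfl
  map_smul' c P := rfl
  invFun c :=
    ⟨fun ξ => ((LinearMap.proj ξ ∘ₗ (SmoothFunction 𝕜 (StrongDual 𝕜 g)).subtype).compAlternatingMap
      c).compLinearMap (linFunEquiv 𝕜 g).symm.toLinearMap, fun _ => smoothFunction_contDiff _⟩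
  left_inv P := Subtype.ext (funext fun ξ => AlternatingMap.ext fun α => by
    change P.1 ξ (fun i => linFunEquiv 𝕜 g ((linFunEquiv 𝕜 g).symm (α i))) = _
    simp)
  right_inv c := AlternatingMap.ext fun x => Subtype.ext (funext fun ξ => by
    change (c fun i => (linFunEquiv 𝕜 g).symm (linFunEquiv 𝕜 g (x i))).1 ξ = _
    simp)

theorem multivectorCochainEquiv_apply {p : ℕ} (P : MultivectorField 𝕜 (StrongDual 𝕜 g) p)
    (x : Fin p → g) (ξ : StrongDual 𝕜 g) :
    (multivectorCochainEquiv 𝕜 g p P x).1 ξ = P.1 ξ fun i => linFun (x i) := rfl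

/-- The insertion of a multivector field into the Lie-Poisson structure is the action part of the
Chevalley-Eilenberg differential. -/
theorem schoutenInsertion_liePoisson_left (π : LieStructure 𝕜 g) {p : ℕ}
    (P : MultivectorField 𝕜 (StrongDual 𝕜 g) p) (h : 2 + p = p + 1 + 1) (x : Fin (p + 1) → g)
    (ξ : StrongDual 𝕜 g) :
    (schoutenInsertion h (liePoisson π) P).1 ξ (fun i => linFun (x i)) =
      (-1) ^ (p + 1) *
        (ceActionPart (liePoissonRep π) p (multivectorCochainEquiv 𝕜 g p P) x).1 ξ := by
  -- The derivative of P fills the first slot of Π and only the last covector remains for the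
  -- second, so it is the distinguished variable.
  let G : StrongDual 𝕜 (StrongDual 𝕜 g) →ₗ[𝕜] (StrongDual 𝕜 (StrongDual 𝕜 g)) [⋀^Fin p]→ₗ[𝕜] 𝕜 :=
    { toFun := fun α => ((ξ : g →ₗ[𝕜] 𝕜) ∘ₗ π.br.flip ((linFunEquiv 𝕜 g).symm α) ∘ₗ
        (linFunEquiv 𝕜 g).symm.toLinearMap).compAlternatingMap (multivectorDerivAt P ξ)
      map_add' := fun α β => by ext; simp
      map_smul' := fun c α => by ext; simp }
  have hG (α : StrongDual 𝕜 (StrongDual 𝕜 g)) (β : Fin p → StrongDual 𝕜 (StrongDual 𝕜 g)) :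
      G α β = ξ (π.br ((linFunEquiv 𝕜 g).symm (fderiv 𝕜 (fun η => P.1 η β) ξ))
        ((linFunEquiv 𝕜 g).symm α)) := rfl
  have h1 := MultilinearMap.alternatization_eq_of_apply_last
    (insertionMultilinear (show p + 1 = p + 1 from rfl) (liePoisson π) P ξ) G fun v => rfl
  change ((p.factorial * Nat.factorial 1 : ℕ) : 𝕜)⁻¹ * (MultilinearMap.alternatization
    (insertionMultilinear (show p + 1 = p + 1 from rfl) (liePoisson π) P ξ))
      (fun i => linFun (x i)) = _
  have hp : (p.factorial : 𝕜) ≠ 0 := Nat.cast_ne_zero.2 p.factorial_ne_zero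
  rw [h1, AlternatingMap.smul_apply, AlternatingMap.smul_apply,
    AlternatingMap.alternatizeUncurryFin_apply, ceActionPart_apply, smoothFunction_sum_apply]
  have h2 : ∀ i : Fin (p + 1), ((-1) ^ (i : ℕ) • liePoissonRep π (x i)
      (multivectorCochainEquiv 𝕜 g p P (i.removeNth x))).1 ξ =
        -((-1 : ℤ) ^ (i : ℕ) • G (linFun (x i)) (i.removeNth fun i => linFun (x i))) := by
    intro i
    rw [smoothFunction_zsmul_apply, ← smul_neg]
    congr 1
    have h3 : (linFunEquiv 𝕜 g).symm (linFun (x i)) = x i :=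
      (linFunEquiv 𝕜 g).symm_apply_apply _
    -- The action has l_x in the first slot of Π, the insertion has it in the second. This minus
    -- sign and the (-1)^p of the rotation make (-1)^(p+1).
    rw [hG, h3, π.br_swap, map_neg, neg_neg]
    exact poissonBracket_liePoisson_apply π (x i) _ ξ
  simp only [h2, Finset.sum_neg_distrib]
  simp only [Nat.factorial_one, mul_one, zsmul_eq_mul, nsmul_eq_mul, Int.cast_pow, Int.cast_neg,
    Int.cast_one, pow_succ]
  field_simp

/-- The insertion of the Lie-Poisson structure into a multivector field is the bracket part of the
Chevalley-Eilenberg differential. -/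
theorem schoutenInsertion_liePoisson_right (π : LieStructure 𝕜 g) {p : ℕ}
    (P : MultivectorField 𝕜 (StrongDual 𝕜 g) p) (h : p + 2 = p + 1 + 1) (x : Fin (p + 1) → g)
    (ξ : StrongDual 𝕜 g) :
    (schoutenInsertion h P (liePoisson π)).1 ξ (fun i => linFun (x i)) =
      -(ceBracketPart π p (multivectorCochainEquiv 𝕜 g p P) x).1 ξ := by
  cases p with
  | zero => exact neg_zero.symm
  | succ p =>
    let G : StrongDual 𝕜 (StrongDual 𝕜 g) →ₗ[𝕜] StrongDual 𝕜 (StrongDual 𝕜 g) →ₗ[𝕜]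
        (StrongDual 𝕜 (StrongDual 𝕜 g)) [⋀^Fin p]→ₗ[𝕜] 𝕜 :=
      (π.br.compl₁₂ (linFunEquiv 𝕜 g).symm.toLinearMap (linFunEquiv 𝕜 g).symm.toLinearMap).compr₂
        ((P.1 ξ).curryLeft ∘ₗ (linFunEquiv 𝕜 g).toLinearMap)
    have h2p : 2 + p = p + 1 + 1 := by omega
    have h1 := MultilinearMap.alternatization_eq_of_apply_head_head
      (insertionMultilinear h2p P (liePoisson π) ξ) G fun v => by
        rw [insertionMultilinear_apply]
        -- The components of Π are linear functions, hence equal to their own differentials; this is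
        -- where a bracket gets inserted into P.
        have hd : fderiv 𝕜 (fun η => (liePoisson π).1 η
            fun i => v (Fin.cast h2p (Fin.castAdd p i))) ξ =
            linFun (π.br ((linFunEquiv 𝕜 g).symm (v 0)) ((linFunEquiv 𝕜 g).symm (v 1))) :=
          ContinuousLinearMap.fderiv (linFun (𝕜 := 𝕜) _)
        rw [hd]
        have ht : (fun j => v (Fin.cast h2p (Fin.natAdd 2 j))) = Fin.tail (Fin.tail v) := by
          funext j
          simp only [Fin.tail]
          congr 1
          ext
          simp only [Fin.val_cast, Fin.val_natAdd, Fin.val_succ]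
          ring
        rw [ht]
        rfl
    change ((Nat.factorial 2 * p.factorial : ℕ) : 𝕜)⁻¹ * (MultilinearMap.alternatization
      (insertionMultilinear h2p P (liePoisson π) ξ)) (fun i => linFun (x i)) =
        -((-(2 : 𝕜)⁻¹) * (AlternatingMap.alternatizeUncurryFin
          (AlternatingMap.alternatizeUncurryFinLM ∘ₗ
            ceBracketAux π (multivectorCochainEquiv 𝕜 g (p + 1) P)) x).1 ξ)
    have hp : (p.factorial : 𝕜) ≠ 0 := Nat.cast_ne_zero.2 p.factorial_ne_zero
    have h3 : (AlternatingMap.alternatizeUncurryFin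
          (AlternatingMap.alternatizeUncurryFinLM ∘ₗ
            ceBracketAux π (multivectorCochainEquiv 𝕜 g (p + 1) P)) x).1 ξ =
        AlternatingMap.alternatizeUncurryFin (R := 𝕜) (M := StrongDual 𝕜 (StrongDual 𝕜 g))
          (N := 𝕜) (AlternatingMap.alternatizeUncurryFinLM ∘ₗ G) (fun i => linFun (x i)) := by
      have hG (y z : g) (w : Fin p → g) :
          (ceBracketAux π (multivectorCochainEquiv 𝕜 g (p + 1) P) y z w).1 ξ =
            G (linFun y) (linFun z) fun i => linFun (w i) := by
        have h4 (y : g) : (linFunEquiv 𝕜 g).symm (linFun y) = y :=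
          (linFunEquiv 𝕜 g).symm_apply_apply _
        change P.1 ξ _ = P.1 ξ (Matrix.vecCons (linFun (π.br ((linFunEquiv 𝕜 g).symm (linFun y))
          ((linFunEquiv 𝕜 g).symm (linFun z)))) _)
        rw [h4, h4]
        congr 1
        funext i
        refine Fin.cases ?_ (fun j => ?_) i <;> rfl
      rw [AlternatingMap.alternatizeUncurryFin_alternatizeUncurryFinLM_comp_apply,
        AlternatingMap.alternatizeUncurryFin_alternatizeUncurryFinLM_comp_apply,
        smoothFunction_sum_apply]
      refine Finset.sum_congr rfl fun i _ => ?_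
      rw [smoothFunction_sum_apply]
      refine Finset.sum_congr rfl fun j _ => ?_
      rw [smoothFunction_zsmul_apply]
      congr 1
      exact congrArg₂ (· - ·) (hG _ _ _) (hG _ _ _)
    -- The p! cancels against 1 / (2! p!), which leaves the 1/2 built into `ceBracketPart`.
    rw [h1, h3, AlternatingMap.smul_apply, nsmul_eq_mul]
    push_cast
    field_simp
    simp [Nat.factorial, mul_comm]

/-- Both the sign left by inserting P into Π and the graded sign of the Schouten bracket equal
(-1)^(p+1), and the prefactor of the Poisson differential removes them. -/
theorem multivectorCochainEquiv_poissonDifferential (π : LieStructure 𝕜 g) (p : ℕ)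
    (P : MultivectorField 𝕜 (StrongDual 𝕜 g) p) :
    multivectorCochainEquiv 𝕜 g (p + 1) (poissonDifferential (liePoisson π) p P) =
      ceDifferential π (liePoissonRep π) p (multivectorCochainEquiv 𝕜 g p P) := by
  refine AlternatingMap.ext fun x => Subtype.ext (funext fun ξ => ?_)
  change (-1 : 𝕜) ^ (p + 1) * ((schoutenInsertion _ (liePoisson π) P).1 ξ (fun i => linFun (x i)) -
    (-1 : 𝕜) ^ ((2 + 1) * (p + 1)) *
      (schoutenInsertion _ P (liePoisson π)).1 ξ (fun i => linFun (x i))) =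
    (ceActionPart (liePoissonRep π) p (multivectorCochainEquiv 𝕜 g p P) x).1 ξ +
      (ceBracketPart π p (multivectorCochainEquiv 𝕜 g p P) x).1 ξ
  rw [schoutenInsertion_liePoisson_left, schoutenInsertion_liePoisson_right]
  have h1 : (-1 : 𝕜) ^ (p + 1) * (-1) ^ (p + 1) = 1 := by
    rw [← mul_pow, neg_one_mul, neg_neg, one_pow]
  have h2 : (-1 : 𝕜) ^ ((2 + 1) * (p + 1)) = (-1) ^ (p + 1) := by
    rw [pow_mul]
    norm_num
  rw [h2]
  linear_combination
    ((ceActionPart (liePoissonRep π) p (multivectorCochainEquiv 𝕜 g p P) x).1 ξ +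
      (ceBracketPart π p (multivectorCochainEquiv 𝕜 g p P) x).1 ξ) * h1

/-- The cochain of the Lie-Poisson structure is the coboundary of `x ↦ l_x`. -/
theorem multivectorCochainEquiv_liePoisson (π : LieStructure 𝕜 g) :
    ∃ c, multivectorCochainEquiv 𝕜 g 2 (liePoisson π) = ceDifferential π (liePoissonRep π) 1 c := by
  let l : g [⋀^Fin 1]→ₗ[𝕜] SmoothFunction 𝕜 (StrongDual 𝕜 g) :=
    AlternatingMap.ofSubsingleton 𝕜 g _ (0 : Fin 1)
      { toFun := linSmooth
        map_add' := fun x y => Subtype.ext (funext fun ξ => map_add ξ x y)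
        map_smul' := fun c x => Subtype.ext (funext fun ξ => map_smul ξ c x) }
  refine ⟨l, AlternatingMap.ext fun x => Subtype.ext (funext fun ξ => ?_)⟩
  have hl (y : Fin 1 → g) : l y = linSmooth (y 0) := rfl
  have hr (y z : g) : (liePoissonRep π y (linSmooth z)).1 ξ = ξ (π.br y z) := by
    rw [liePoissonRep_apply, fderiv_linSmooth, linFun_apply, LieStructure.coadjoint_apply]
  have h1 : (multivectorCochainEquiv 𝕜 g 2 (liePoisson π) x).1 ξ = ξ (π.br (x 0) (x 1)) := by
    have h := liePoisson_apply π ξ (x 0) (x 1)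
    rw [multivectorCochainEquiv_apply, ← linFun_apply, ← h]
    congr 1
    funext i
    fin_cases i <;> rfl
  change _ = (ceActionPart (liePoissonRep π) 1 l x).1 ξ + (ceBracketPart π 1 l x).1 ξ
  rw [h1, ceActionPart_apply, ceBracketPart_succ_apply, smoothFunction_sum_apply,
    smoothFunction_sum_apply]
  rw [Fin.sum_univ_two, Fin.sum_univ_one, smoothFunction_sum_apply]
  have h2 : (1 : Fin 2).removeNth x 0 = x 0 := rfl
  have h3 : (linSmooth (𝕜 := 𝕜) (π.br (x 0) (x 1))).1 ξ = ξ (π.br (x 0) (x 1)) := rfl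
  have h4 : Fin.tail x 0 = x 1 := rfl
  -- The two action terms each give l_[x₀,x₁] and the bracket term subtracts one, so exactly one
  -- copy is left.
  simp [hl, hr, h2, h3, h4, π.br_swap (x 0) (x 1)]

/-- Up to sign, [Π, Π] is the Poisson differential of Π, and Π corresponds to a coboundary. -/
theorem liePoisson_isPoisson (π : LieStructure 𝕜 g) : IsPoisson (liePoisson π) := by
  have h : poissonDifferential (liePoisson π) 2 (liePoisson π) = 0 := by
    apply (multivectorCochainEquiv 𝕜 g 3).injective
    obtain ⟨c, hc⟩ := multivectorCochainEquiv_liePoisson π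
    rw [multivectorCochainEquiv_poissonDifferential, hc,
      ceDifferential_ceDifferential (liePoissonRep_isRepresentation π), map_zero]
  have h1 : (-1 : 𝕜) ^ (2 + 1) • schouten (show 2 + 2 = 3 + 1 from rfl) (liePoisson π)
    (liePoisson π) = 0 := h
  unfold IsPoisson
  simpa using h1

end LiePoissonCochain

/-! ### Transport of double differentials and their kernel complexes along linear equivalences. -/

section Transport

variable {𝕜 : Type u} [Field 𝕜] {C D : ℕ → Type w} [∀ n, AddCommGroup (C n)]
  [∀ n, Module 𝕜 (C n)] [∀ n, AddCommGroup (D n)] [∀ n, Module 𝕜 (D n)]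
  {a b : ∀ n, C n →ₗ[𝕜] C (n + 1)} {a' b' : ∀ n, D n →ₗ[𝕜] D (n + 1)}

theorem AnticommutingDifferentials.of_linearEquiv (h : AnticommutingDifferentials a' b')
    (e : ∀ n, C n ≃ₗ[𝕜] D n) (ha : ∀ n x, e (n + 1) (a n x) = a' n (e n x))
    (hb : ∀ n x, e (n + 1) (b n x) = b' n (e n x)) : AnticommutingDifferentials a b where
  sq_fst n x := (e _).injective (by rw [ha, ha, h.sq_fst, map_zero])
  sq_snd n x := (e _).injective (by rw [hb, hb, h.sq_snd, map_zero])
  anticomm n x := (e _).injective (by rw [map_add, ha, hb, hb, ha, h.anticomm, map_zero])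

theorem AnticommutingDifferentials.mem_ker (h : AnticommutingDifferentials a b) (n : ℕ) :
    ∀ x ∈ LinearMap.ker (a n), b n x ∈ LinearMap.ker (a (n + 1)) := fun x hx => by
  have h1 := h.anticomm n x
  rw [LinearMap.mem_ker] at hx ⊢
  rwa [hx, map_zero, add_zero] at h1

theorem kernelComplex_d (h : AnticommutingDifferentials a b) (n : ℕ)
    (x : LinearMap.ker (a n)) :
    (((kernelComplex h).d n (n + 1)).hom x : LinearMap.ker (a (n + 1))).1 = b n x.1 := by
  have h1 : (kernelComplex h).d n (n + 1) = ModuleCat.ofHom ((b n).restrict (h.mem_ker n)) :=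
    CochainComplex.of_d (fun n => ModuleCat.of 𝕜 (LinearMap.ker (a n)))
      (fun n => ModuleCat.ofHom ((b n).restrict (h.mem_ker n))) n
  rw [h1]
  rfl

/-- Degreewise linear equivalences that commute with both differentials induce an isomorphism of
the complexes of cocycles. -/
noncomputable def kernelComplexIso (h : AnticommutingDifferentials a b)
    (h' : AnticommutingDifferentials a' b')
    (e : ∀ n, C n ≃ₗ[𝕜] D n) (ha : ∀ n x, e (n + 1) (a n x) = a' n (e n x))
    (hb : ∀ n x, e (n + 1) (b n x) = b' n (e n x)) : kernelComplex h ≅ kernelComplex h' :=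
  HomologicalComplex.Hom.isoOfComponents
    (fun n => LinearEquiv.toModuleIso (X₁ := LinearMap.ker (a n)) (X₂ := LinearMap.ker (a' n))
      ((e n).ofSubmodules _ _ (by
        ext y
        -- Injectivity of e one degree higher makes the two kernel conditions equivalent, so e maps
        -- one kernel onto the other.
        rw [Submodule.mem_map_equiv, LinearMap.mem_ker, LinearMap.mem_ker,
          ← (e (n + 1)).map_eq_zero_iff, ha, LinearEquiv.apply_symm_apply])))
    (fun i j hij => by
      obtain rfl : i + 1 = j := hij
      refine ModuleCat.hom_ext (LinearMap.ext fun x => Subtype.ext ?_)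
      refine (kernelComplex_d h' i _).trans ?_
      refine Eq.trans ?_ (congrArg (e (i + 1)) (kernelComplex_d h i x)).symm
      exact (hb i _).symm)

end Transport

/-! ### The isomorphism of complexes and of cohomology. -/

theorem mainTheorem5 {𝕜 : Type u} [RCLike 𝕜] {g : Type v} [NormedAddCommGroup g]
    [NormedSpace 𝕜 g] [FiniteDimensional 𝕜 g] (L : CompatibleLieStructure 𝕜 g) :
    IsBiHamiltonian (liePoisson L.fst) (liePoisson L.snd) ∧
    L.IsRepresentation (liePoissonRep L.fst) (liePoissonRep L.snd) ∧
    ∃ (hX : AnticommutingDifferentials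
          (C := fun p => MultivectorField 𝕜 (StrongDual 𝕜 g) p)
          (poissonDifferential (liePoisson L.fst)) (poissonDifferential (liePoisson L.snd)))
      (hC : AnticommutingDifferentials
          (C := fun p => g [⋀^Fin p]→ₗ[𝕜] SmoothFunction 𝕜 (StrongDual 𝕜 g))
          (ceDifferential L.fst (liePoissonRep L.fst))
          (ceDifferential L.snd (liePoissonRep L.snd)))
      (Ψ : biHamiltonianComplex hX ≅ reducedComplex hC),
      (∀ (p : ℕ) (P : LinearMap.ker (poissonDifferential (liePoisson L.fst) p))
          (x : Fin p → g) (ξ : StrongDual 𝕜 g),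
        (((Ψ.hom.f p).hom P :
            LinearMap.ker (ceDifferential L.fst (liePoissonRep L.fst) p)).1 x).1 ξ =
          P.1.1 ξ fun i => linFun (x i)) ∧
      ∀ n : ℕ, ∃ Φ : (biHamiltonianComplex hX).homology n ≅ (reducedComplex hC).homology n,
        Φ.hom = HomologicalComplex.homologyMap Ψ.hom n := by
  have hsum : (L.combination 1 1).IsRepresentation
      (liePoissonRep L.fst + liePoissonRep L.snd) := by
    have h := liePoissonRep_combination L 1 1
    rw [one_smul, one_smul] at h
    rw [← h]
    exact liePoissonRep_isRepresentation _
  have h1 := liePoissonRep_isRepresentation L.fst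
  have h2 := liePoissonRep_isRepresentation L.snd
  have hC := ceDifferential_anticommutingDifferentials h1 h2 hsum
  -- The identities for the Poisson differentials are pulled back from cochains.
  have hX : AnticommutingDifferentials (C := fun p => MultivectorField 𝕜 (StrongDual 𝕜 g) p)
      (poissonDifferential (liePoisson L.fst)) (poissonDifferential (liePoisson L.snd)) :=
    hC.of_linearEquiv (multivectorCochainEquiv 𝕜 g)
      (multivectorCochainEquiv_poissonDifferential L.fst)
      (multivectorCochainEquiv_poissonDifferential L.snd)
  refine ⟨fun a b => ?_, CompatibleLieStructure.isRepresentation_of_add h1 h2 hsum, hX, hC,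
    kernelComplexIso hX hC (multivectorCochainEquiv 𝕜 g)
      (multivectorCochainEquiv_poissonDifferential L.fst)
      (multivectorCochainEquiv_poissonDifferential L.snd), fun p P x ξ => rfl, fun n => ?_⟩
  · rw [← liePoisson_combination]
    exact liePoisson_isPoisson _
  · exact ⟨HomologicalComplex.homologyMapIso _ n, rfl⟩
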